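/- Let $G$ be a finitely generated nilpotent group. For a subgroup $H\subseteq G$ let $H^{*}$ be the smallest subgroup of $G$ that contains $H$ and is closed under roots (if $g^{i}\in H^{*}$ for some $i\geq 1$, then $g\in H^{*}$). An irreducible weight pair is a pair $(H,\chi)$ of a subgroup $H\subseteq G$ and a character $\chi\colon H\to\mathbb{C}^{*}$ such that the finitely induced representation $\operatorname{ind}_H^G(\chi)=\mathbb{C}[G]\otimes_{\mathbb{C}[H]}\chi$ is irreducible; write $(H_1,\chi_1)\sim(H_2,\chi_2)$ if $\operatorname{ind}_{H_1}^G(\chi_1)\simeq\operatorname{ind}_{H_2}^G(\chi_2)$. Let $Y$ be the set of irreducible weight pairs and let $\Sigma$ be the set of subgroups $H$ that occur in such pairs. For $H\in\Sigma$ let $Y_H$ be the fibre of $Y\to\Sigma$ over $H$, let $Z_H=Y_H/\!\sim$, and let $Z=\bigsqcup_{H\in\Sigma}Z_H$. Let $W=Y/\!\sim_{*}$, where $(H_1,\chi_1)\sim_{*}(H_2,\chi_2)$ means that $(H_1,\chi_1)\sim(H_2,\chi_2)$ and $H_1^{*}=H_2^{*}$. Let $\varphi\colon Z\to W$ be the natural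 map that sends the class of $(H,\chi)$ in $Z_H$ to its class in $W$. Then for every $w\in W$ the fibre $\varphi^{-1}(w)\subseteq Z$ is finite. Equivalently, for every irreducible weight pair $(H,\chi)$ there are only finitely many classes in $Z$ of irreducible weight pairs $(H',\chi')$ with $(H',\chi')\sim(H,\chi)$ and $H'^{*}=H^{*}$. -/

import Mathlib

namespace WeightPairs

/-- The one-dimensional complex representation on `ℂ` given by a character `χ : H → ℂˣ`. -/
noncomputable def charRep {H : Type*} [Group H] (χ : H →* ℂˣ) : Representation ℂ H ℂ where
  toFun h := LinearMap.lsmul ℂ ℂ (χ h : ℂ)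
  map_one' := by ext; simp
  map_mul' a b := by ext; simp

/-- The finitely induced representation `ind_H^G(χ)`, i.e. `ℂ[G] ⊗_{ℂ[H]} χ`. -/
noncomputable abbrev indChar {G : Type*} [Group G] (H : Subgroup G) (χ : H →* ℂˣ) :
    Representation ℂ G (Representation.IndV H.subtype (charRep χ)) :=
  Representation.ind H.subtype (charRep χ)

/-- A subgroup `K` is closed under taking roots in `G`. -/
def RootClosed {G : Type*} [Group G] (K : Subgroup G) : Prop :=
  ∀ (g : G) (i : ℕ), 0 < i → g ^ i ∈ K → g ∈ K

/-- `H^*`, the smallest subgroup of `G` that contains `H` and is closed under taking roots. -/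
def isolator {G : Type*} [Group G] (H : Subgroup G) : Subgroup G :=
  sInf {K : Subgroup G | H ≤ K ∧ RootClosed K}

theorem isolator_isLeast {G : Type*} [Group G] (H : Subgroup G) :
    IsLeast {K : Subgroup G | H ≤ K ∧ RootClosed K} (isolator H) := by
  refine ⟨⟨le_sInf fun K hK => hK.1, fun g i hi hg => ?_⟩, fun K hK => sInf_le hK⟩
  rw [isolator, Subgroup.mem_sInf] at hg ⊢
  exact fun K hK => hK.2 g i hi (hg K hK)

/-- The set `Y` of irreducible weight pairs `(H, χ)` of `G`. -/
structure Y (G : Type*) [Group G] where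
  subgroup : Subgroup G
  character : subgroup →* ℂˣ
  irreducible : (indChar subgroup character).IsIrreducible

/-- Equivalence of weight pairs: the induced representations are isomorphic. -/
def Equivalent {G : Type*} [Group G] (p q : Y G) : Prop :=
  Nonempty ((indChar p.subgroup p.character).Equiv (indChar q.subgroup q.character))

theorem equivalent_equivalence (G : Type*) [Group G] :
    Equivalence (Equivalent : Y G → Y G → Prop) :=
  ⟨fun _ => ⟨Representation.Equiv.refl _⟩, fun ⟨e⟩ => ⟨e.symm⟩, fun ⟨e⟩ ⟨f⟩ => ⟨e.trans f⟩⟩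

/-- The set of subgroups `H` of `G` (the base, usually denoted by a capital sigma) for which there
is a character `χ` such that `(H, χ)` is an irreducible weight pair. -/
def Base (G : Type*) [Group G] : Type _ :=
  {H : Subgroup G // ∃ χ : H →* ℂˣ, (indChar H χ).IsIrreducible}

/-- The natural surjection from `Y` to the base. -/
def toBase {G : Type*} [Group G] (p : Y G) : Base G :=
  ⟨p.subgroup, p.character, p.irreducible⟩

/-- The fibre `Y_H` of `Y` over a subgroup `H` in the base. -/
def YFibre {G : Type*} [Group G] (H : Base G) : Type _ :=
  {p : Y G // toBase p = H}

/-- The equivalence `∼_f` on the fibre `Y_H`. -/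
def fibreSetoid {G : Type*} [Group G] (H : Base G) : Setoid (YFibre H) where
  r p q := Equivalent p.1 q.1
  iseqv := (equivalent_equivalence G).comap Subtype.val

/-- The bundle `Z` over the base, with fibre `Z_H = Y_H / ∼_f` over `H`. -/
def Z (G : Type*) [Group G] : Type _ :=
  (H : Base G) × Quotient (fibreSetoid H)

/-- The equivalence `∼_*` on `Y`: the pairs are equivalent and `H₁^* = H₂^*`. -/
def starSetoid (G : Type*) [Group G] : Setoid (Y G) where
  r p q := Equivalent p q ∧ isolator p.subgroup = isolator q.subgroup
  iseqv :=
    ⟨fun p => ⟨(equivalent_equivalence G).refl p, rfl⟩,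
      fun h => ⟨(equivalent_equivalence G).symm h.1, h.2.symm⟩,
      fun h k => ⟨(equivalent_equivalence G).trans h.1 k.1, h.2.trans k.2⟩⟩

/-- The quotient `W = Y / ∼_*`. -/
def W (G : Type*) [Group G] : Type _ :=
  Quotient (starSetoid G)

theorem isolator_eq_of_fibre {G : Type*} [Group G] {H : Base G} (p q : YFibre H) :
    isolator p.1.subgroup = isolator q.1.subgroup := by
  have hp : p.1.subgroup = H.1 := congrArg Subtype.val p.2
  have hq : q.1.subgroup = H.1 := congrArg Subtype.val q.2
  rw [hp, hq]

/-- The natural map `φ : Z → W`, sending the class of `(H, χ)` in `Z_H` to its class in `W`. -/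
def phi {G : Type*} [Group G] (z : Z G) : W G :=
  Quotient.lift (s := fibreSetoid z.1) (fun p : YFibre z.1 => (Quotient.mk (starSetoid G) p.1 : W G))
    (fun p q h => Quotient.sound (s := starSetoid G) ⟨h, isolator_eq_of_fibre p q⟩) z.2

end WeightPairs

/-! ### Finite generation of subgroups of finitely generated nilpotent groups. -/

namespace WeightPairs

open Subgroup
open scoped commutatorElement

/-! A class in `Z` lying over a given `w` is determined by its subgroup (`injOn_fst_fibre`), so it
suffices to bound the subgroups. Put `K = H^*`. Every competing `H'` has finite index in `K`
(`relIndex_isolator_ne_zero`), and `K` is finitely generated, so it has finitely many subgroups of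
bounded index. What remains is the bound `[K : H'] ≤ [K : H]` (`relIndex_le_of_equiv`).

For this, realize the induced representations as functions on `G` that are equivariant under left
translation by the inducing subgroup. Let `f` be an isomorphism from the representation induced from
`H'` to the one induced from `H`, and choose `g` where the image of the canonical generator does not
vanish. Finite support modulo `H` and root-closedness of `K` force `g K g⁻¹ ⊆ K`. The vectors
supported on `K` form a space of dimension `[K : H']`. Sending such a `u` to the restriction of `f
u` to `K g`, which is determined by `[K : H]` values, is injective: the kernel is `K`-stable, and
irreducibility makes it zero (`eq_zero_of_support_of_vanish`). -/

theorem lowerCentralSeries_le_center {G : Type*} [Group G] {n : ℕ}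
    (h : (⊤ : Subgroup G).lowerCentralSeries (n + 1) = ⊥) :
    (⊤ : Subgroup G).lowerCentralSeries n ≤ center G := by
  rw [Subgroup.lowerCentralSeries_succ, commutator_eq_bot_iff_le_centralizer] at h
  rwa [coe_top, centralizer_univ] at h

theorem lowerCentralSeries_quotient_eq_bot {G : Type*} [Group G] (n : ℕ) :
    (⊤ : Subgroup (G ⧸ (⊤ : Subgroup G).lowerCentralSeries n)).lowerCentralSeries n = ⊥ := by
  have h := map_lowerCentralSeries ⊤
    (QuotientGroup.mk' ((⊤ : Subgroup G).lowerCentralSeries n)) n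
  rw [map_top_of_surjective _ (QuotientGroup.mk'_surjective _)] at h
  rw [← h, QuotientGroup.map_mk'_self]

/-- Commutators of generators control the commutator subgroup `⁅A, G⁆`. -/
theorem commutator_le_of_closure {G : Type*} [Group G] {S : Set G} (hS : closure S = ⊤)
    {A N : Subgroup G} [N.Normal] {T : Set G} (hA : A ≤ closure T)
    (hTS : ∀ t ∈ T, ∀ s ∈ S, ⁅t, s⁆ ∈ N) : ⁅A, (⊤ : Subgroup G)⁆ ≤ N := by
  have key : ∀ x y : G, ⁅x, y⁆ ∈ N ↔
      (QuotientGroup.mk' N x) * QuotientGroup.mk' N y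
        = QuotientGroup.mk' N y * QuotientGroup.mk' N x := by
    intro x y
    rw [← commutatorElement_eq_one_iff_mul_comm, ← map_commutatorElement,
      ← MonoidHom.mem_ker, QuotientGroup.ker_mk']
  have hA' : ∀ a ∈ A, ∀ s ∈ S, ⁅a, s⁆ ∈ N := by
    intro a ha s hs
    have : Subgroup.closure T ≤ (centralizer {QuotientGroup.mk' N s}).comap (QuotientGroup.mk' N) := by
      rw [closure_le]
      intro t ht
      simpa [mem_centralizer_iff] using ((key t s).1 (hTS t ht s hs)).symm
    rw [key]
    exact (mem_centralizer_singleton_iff.1 (this (hA ha)))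
  rw [commutator_le]
  intro a ha g _
  have : closure S ≤ (centralizer {QuotientGroup.mk' N a}).comap (QuotientGroup.mk' N) := by
    rw [closure_le]
    intro s hs
    simpa [mem_centralizer_iff] using (key a s).1 (hA' a ha s hs)
  rw [hS] at this
  rw [key]
  exact (mem_centralizer_singleton_iff.1 (this (mem_top g))).symm

/-- `H` is finitely generated if `H ⊓ N` and the image of `H` in `G ⧸ N` are. -/
theorem fg_of_fg_inf_of_fg_map {G : Type*} [Group G] {N : Subgroup G} [N.Normal]
    {H : Subgroup G} (hN : (H ⊓ N).FG) (hQ : (H.map (QuotientGroup.mk' N)).FG) : H.FG := by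
  classical
  obtain ⟨T, hT⟩ := hQ
  have hsub : (T : Set (G ⧸ N)) ⊆ QuotientGroup.mk' N '' (H : Set G) := by
    rw [← coe_map, ← hT]; exact subset_closure
  obtain ⟨S, hSH, hST⟩ := Finset.subset_set_image_iff.1 hsub
  have hS : Subgroup.closure (S : Set G) ≤ H := (closure_le _).2 hSH
  have : H = Subgroup.closure (S : Set G) ⊔ (H ⊓ N) := by
    apply le_antisymm _ (sup_le hS inf_le_left)
    intro x hx
    have hx' : QuotientGroup.mk' N x ∈ (closure (S : Set G)).map (QuotientGroup.mk' N) := by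
      rw [MonoidHom.map_closure, ← Finset.coe_image, hST, hT]
      exact mem_map_of_mem _ hx
    obtain ⟨y, hy, hxy⟩ := hx'
    have hyx : y⁻¹ * x ∈ N := QuotientGroup.eq.1 hxy
    rw [← mul_inv_cancel_left y x]
    exact Subgroup.mul_mem _ (le_sup_left (a := Subgroup.closure (S : Set G)) hy)
      (le_sup_right (a := Subgroup.closure (S : Set G)) ⟨H.mul_mem (H.inv_mem (hS hy)) hx, hyx⟩)
  rw [this]
  exact FG.sup ⟨S, rfl⟩ hN

/-- A central subgroup is a `ℤ`-module, and `ℤ` is Noetherian. -/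
theorem fg_of_le_center {G : Type*} [Group G] {A B : Subgroup G} (hA : A ≤ center G)
    (hfg : A.FG) (hB : B ≤ A) : B.FG := by
  have : IsMulCommutative A := ⟨⟨fun x y => Subtype.ext (mem_center_iff.1 (hA y.2) x)⟩⟩
  let _ : CommGroup A := { (inferInstance : Group A) with mul_comm := this.1.1 }
  have : Group.FG A := (Group.fg_iff_subgroup_fg A).2 hfg
  have : Module.Finite ℤ (Additive A) := Module.Finite.iff_addGroup_fg.2 inferInstance
  have : IsNoetherian ℤ (Additive A) := isNoetherian_of_isNoetherianRing_of_finite ℤ _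
  have h1 := IsNoetherian.noetherian (AddSubgroup.toIntSubmodule (B.subgroupOf A).toAddSubgroup)
  have h2 : (B.subgroupOf A).toAddSubgroup.FG := by
    have := (Submodule.fg_iff_addSubgroup_fg _).1 h1
    simpa using this
  have h3 : (B.subgroupOf A).FG := (fg_iff_add_fg _).2 h2
  have : Group.FG (B.subgroupOf A) := (Group.fg_iff_subgroup_fg _).2 h3
  have h4 : Group.FG B := Group.fg_of_surjective
    (f := (subgroupOfEquivOfLe hB).toMonoidHom) (subgroupOfEquivOfLe hB).surjective
  exact (Group.fg_iff_subgroup_fg _).1 h4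

/-- The last nontrivial term is central, so a commutator `⁅t, s⁆` landing in it depends on `t` only
modulo that term. Finitely many `t`, lifted from generators in the quotient, and finitely many
generators `s` of `G` therefore suffice. -/
theorem lowerCentralSeries_fg {G : Type*} [Group G] [Group.FG G] {n : ℕ}
    (h : (⊤ : Subgroup G).lowerCentralSeries (n + 1) = ⊥)
    (ih : ∀ H : Subgroup (G ⧸ (⊤ : Subgroup G).lowerCentralSeries n), H.FG) :
    ((⊤ : Subgroup G).lowerCentralSeries n).FG := by
  classical
  have hc := lowerCentralSeries_le_center h
  obtain ⟨S, hS⟩ := Group.fg_def.1 ‹Group.FG G›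
  cases n with
  | zero => exact ⟨S, hS⟩
  | succ k =>
    set Z := (⊤ : Subgroup G).lowerCentralSeries (k + 1) with hZ
    obtain ⟨T, hT⟩ := ih (((⊤ : Subgroup G).lowerCentralSeries k).map (QuotientGroup.mk' Z))
    have hsub : (T : Set (G ⧸ Z)) ⊆
        QuotientGroup.mk' Z '' ((⊤ : Subgroup G).lowerCentralSeries k : Set G) := by
      rw [← coe_map, ← hT]; exact subset_closure
    obtain ⟨T', hTA, hTT⟩ := Finset.subset_set_image_iff.1 hsub
    set C := Subgroup.closure ((T' ×ˢ S).image (fun p => ⁅p.1, p.2⁆) : Set G) with hC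
    have hCZ : C ≤ Z := by
      rw [hC, closure_le]
      intro z hz
      simp only [Finset.coe_image, Finset.coe_product, Set.mem_image, Set.mem_prod] at hz
      obtain ⟨⟨t, s⟩, ⟨ht, -⟩, rfl⟩ := hz
      exact commutator_mem_commutator (hTA ht) (mem_top s)
    have : C.Normal := ⟨fun c hc' g => by
      rw [mem_center_iff.1 (hc (hCZ hc')) g, mul_inv_cancel_right]; exact hc'⟩
    have hle : Z ≤ C := by
      rw [hZ, Subgroup.lowerCentralSeries_succ]
      -- Adjoining all of `Z` to the lifts generates the preceding term; being central, it
      -- contributes only trivial commutators.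
      refine commutator_le_of_closure hS (T := T' ∪ (Z : Set G)) ?_ ?_
      · intro x hx
        have hx' : QuotientGroup.mk' Z x ∈ (closure (T' : Set G)).map (QuotientGroup.mk' Z) := by
          rw [MonoidHom.map_closure, ← Finset.coe_image, hTT, hT]
          exact mem_map_of_mem _ hx
        obtain ⟨y, hy, hxy⟩ := hx'
        have hyx : y⁻¹ * x ∈ Z := QuotientGroup.eq.1 hxy
        rw [← mul_inv_cancel_left y x]
        exact mul_mem (closure_mono Set.subset_union_left hy)
          (subset_closure (Set.mem_union_right _ hyx))
      · rintro t (ht | ht) s hs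
        · apply Subgroup.subset_closure
          simp only [Finset.coe_image, Finset.coe_product, Set.mem_image, Set.mem_prod]
          exact ⟨(t, s), ⟨ht, hs⟩, rfl⟩
        · rw [commutatorElement_eq_one_iff_mul_comm.2 (mem_center_iff.1 (hc ht) s).symm]
          exact one_mem _
    rw [le_antisymm hle hCZ]
    exact ⟨_, rfl⟩

theorem subgroup_fg_of_lowerCentralSeries_eq_bot (n : ℕ) {G : Type*} [Group G] [Group.FG G]
    (h : (⊤ : Subgroup G).lowerCentralSeries n = ⊥) (H : Subgroup G) : H.FG := by
  induction n generalizing G with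
  | zero =>
    have : H = ⊥ := eq_bot_iff.2 (le_top.trans h.le)
    rw [this]; exact FG.bot
  | succ n ih =>
    have ih' := fun K => ih (lowerCentralSeries_quotient_eq_bot (G := G) n) K
    exact fg_of_fg_inf_of_fg_map (N := (⊤ : Subgroup G).lowerCentralSeries n)
      (fg_of_le_center (lowerCentralSeries_le_center h) (lowerCentralSeries_fg h ih')
        inf_le_right) (ih' _)

/-- Every subgroup of a finitely generated nilpotent group is finitely generated. -/
theorem subgroup_fg_of_isNilpotent {G : Type*} [Group G] [Group.FG G] [Group.IsNilpotent G]
    (H : Subgroup G) : H.FG := by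
  obtain ⟨n, hn⟩ := Subgroup.nilpotent_iff_lowerCentralSeries.1 ‹Group.IsNilpotent G›
  exact subgroup_fg_of_lowerCentralSeries_eq_bot n hn H

/-! ### Finite index of a subgroup in its isolator. -/

/-- In an abelian group, having a positive power in `H` passes from generators to all elements, and
a finitely generated abelian torsion group is finite. -/
theorem relIndex_ne_zero_of_le_center {G : Type*} [Group G] {Z H : Subgroup G}
    (hZ : Z ≤ center G) (hfg : Z.FG) {T : Set G} (hT : Z = closure T)
    (h : ∀ t ∈ T, ∃ m : ℕ, 0 < m ∧ t ^ m ∈ H) : H.relIndex Z ≠ 0 := by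
  have hp : ∀ z ∈ Z, ∃ m : ℕ, 0 < m ∧ z ^ m ∈ H := by
    intro z hz
    rw [hT] at hz
    induction hz using closure_induction with
    | mem x hx => exact h x hx
    | one => exact ⟨1, one_pos, by simp⟩
    | mul x y hx hy hx' hy' =>
      obtain ⟨m, hm, hxm⟩ := hx'
      obtain ⟨k, hk, hyk⟩ := hy'
      have hcomm : Commute x y := (mem_center_iff.1 (hZ (hT ▸ hx)) y).symm
      refine ⟨m * k, mul_pos hm hk, ?_⟩
      rw [hcomm.mul_pow, pow_mul, mul_comm m k, pow_mul]
      exact mul_mem (pow_mem hxm k) (pow_mem hyk m)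
    | inv x hx hx' =>
      obtain ⟨m, hm, hxm⟩ := hx'
      exact ⟨m, hm, by rw [inv_pow]; exact inv_mem hxm⟩
  have hc : ∀ x y : Z, x * y = y * x := fun x y => Subtype.ext (mem_center_iff.1 (hZ y.2) x)
  let _ : CommGroup Z := { (inferInstance : Group Z) with mul_comm := hc }
  have : Group.FG Z := (Group.fg_iff_subgroup_fg Z).2 hfg
  have : Finite (Z ⧸ H.subgroupOf Z) := by
    apply CommGroup.finite_of_fg_isMulTorsion
    rintro ⟨z⟩
    obtain ⟨m, hm, hz⟩ := hp z z.2
    exact isOfFinOrder_iff_pow_eq_one.2 ⟨m, hm, (QuotientGroup.eq_one_iff (z ^ m)).2 hz⟩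
  exact index_ne_zero_of_finite

theorem pow_mul_eq_of_mul_eq {G : Type*} [Group G] {x g c : G} (hc : c ∈ center G)
    (h : x * g = c * (g * x)) (a : ℕ) : x ^ a * g = c ^ a * (g * x ^ a) := by
  induction a with
  | zero => simp
  | succ a ih =>
    rw [pow_succ', mul_assoc, ih, ← mul_assoc x, ← mem_center_iff.1 (pow_mem hc a) x |>.symm]
    rw [mul_assoc, ← mul_assoc x, h, pow_succ]
    simp only [mul_assoc]

theorem commutatorElement_pow_of_mem_center {G : Type*} [Group G] {x g : G}
    (hc : ⁅x, g⁆ ∈ center G) (a b : ℕ) : ⁅x ^ a, g ^ b⁆ = ⁅x, g⁆ ^ (a * b) := by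
  have h1 : x * g = ⁅x, g⁆ * (g * x) := by simp [commutatorElement_def]
  have h2 := pow_mul_eq_of_mul_eq hc h1 a
  have h3 := pow_mul_eq_of_mul_eq (x := g) (g := x ^ a) (inv_mem (pow_mem hc a))
    (by rw [h2, inv_mul_cancel_left]) b
  have h4 : x ^ a * g ^ b = ⁅x, g⁆ ^ (a * b) * (g ^ b * x ^ a) := by
    rw [h3, pow_mul, inv_pow, mul_inv_cancel_left]
  rw [commutatorElement_def, h4]
  group

theorem relIndex_sup_of_le_center {G : Type*} [Group G] {Z : Subgroup G} (H : Subgroup G)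
    (hZ : Z ≤ center G) : H.relIndex (H ⊔ Z) = H.relIndex Z := by
  rw [sup_comm]
  let _ := normal_subgroupOf_of_le_normalizer
    (hZ.trans (center_le_normalizer (H : Set G)))
  let _ := normal_subgroupOf_sup_of_le_normalizer
    (hZ.trans (center_le_normalizer (H : Set G)))
  exact (Nat.card_congr (QuotientGroup.quotientInfEquivProdNormalizerQuotient Z H
    (hZ.trans (center_le_normalizer _))).toEquiv).symm

/-- A finitely generated nilpotent group generated by roots of elements of `H` contains `H` as a
subgroup of finite index. -/
theorem index_ne_zero_of_closure_roots (n : ℕ) {G : Type*} [Group G] [Group.FG G]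
    (hn : (⊤ : Subgroup G).lowerCentralSeries n = ⊥) {H : Subgroup G} {S : Set G}
    (hS : closure S = ⊤) (h : ∀ s ∈ S, ∃ m : ℕ, 0 < m ∧ s ^ m ∈ H) : H.index ≠ 0 := by
  induction n generalizing G with
  | zero =>
    have : H = ⊤ := eq_top_iff.2 (fun x _ => by
      rw [(eq_bot_iff_forall _).1 hn x (mem_top x)]; exact one_mem _)
    simp [this]
  | succ n ih =>
    have hc := lowerCentralSeries_le_center hn
    have hfg := subgroup_fg_of_lowerCentralSeries_eq_bot _ hn
      ((⊤ : Subgroup G).lowerCentralSeries n)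
    have h1 : (H ⊔ (⊤ : Subgroup G).lowerCentralSeries n).index ≠ 0 := by
      have := ih (lowerCentralSeries_quotient_eq_bot (G := G) n)
        (H := H.map (QuotientGroup.mk' _)) (S := QuotientGroup.mk' _ '' S)
        (by rw [← MonoidHom.map_closure, hS,
              map_top_of_surjective _ (QuotientGroup.mk'_surjective _)])
        (by
          rintro _ ⟨s, hs, rfl⟩
          obtain ⟨m, hm, hsm⟩ := h s hs
          exact ⟨m, hm, by rw [← map_pow]; exact mem_map_of_mem _ hsm⟩)
      rw [← index_comap_of_surjective _ (QuotientGroup.mk'_surjective _), comap_map_eq,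
        QuotientGroup.ker_mk'] at this
      exact this
    have h2 : H.relIndex ((⊤ : Subgroup G).lowerCentralSeries n) ≠ 0 := by
      cases n with
      | zero => exact relIndex_ne_zero_of_le_center hc hfg hS.symm h
      | succ k =>
        refine relIndex_ne_zero_of_le_center hc hfg (T := {z | ∃ p ∈
          (⊤ : Subgroup G).lowerCentralSeries k, ∃ q ∈ (⊤ : Subgroup G), ⁅p, q⁆ = z}) ?_ ?_
        · ext z; exact Subgroup.mem_lowerCentralSeries_succ_iff _ _ _
        -- By induction `x ^ a` and `g ^ b` lie in `H` up to central factors. These drop out of the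
        -- commutator, and bilinearity gives `⁅x, g⁆ ^ (a * b) = ⁅x ^ a, g ^ b⁆ ∈ H`.
        · rintro _ ⟨x, hx, g, -, rfl⟩
          have hz : ⁅x, g⁆ ∈ center G := hc (commutator_mem_commutator hx (mem_top g))
          obtain ⟨a, ha, hxa⟩ := exists_pow_mem_of_index_ne_zero h1 x
          obtain ⟨b, hb, hgb⟩ := exists_pow_mem_of_index_ne_zero h1 g
          obtain ⟨y, hy, z, hz', hyz⟩ := mem_sup_of_normal_right.1 hxa.2
          obtain ⟨y', hy', z', hz'', hyz'⟩ := mem_sup_of_normal_right.1 hgb.2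
          refine ⟨a * b, mul_pos ha hb, ?_⟩
          rw [← commutatorElement_pow_of_mem_center hz, ← hyz, ← hyz']
          have e : ⁅y * z, y' * z'⁆ = ⁅y, y'⁆ := by
            have c1 := fun t => mem_center_iff.1 (hc hz') t
            have c2 := fun t => mem_center_iff.1 (hc hz'') t
            calc ⁅y * z, y' * z'⁆ = y * (z * (y' * z')) * z⁻¹ * y⁻¹ * z'⁻¹ * y'⁻¹ := by
                  simp [commutatorElement_def, mul_assoc]
              _ = (y * y') * z' * y⁻¹ * z'⁻¹ * y'⁻¹ := by
                  rw [← c1]; group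
              _ = ⁅y, y'⁆ := by
                  rw [c2 (y * y'), mul_assoc z', mul_assoc z', ← c2]; simp [commutatorElement_def]
          rw [e, commutatorElement_def]
          exact mul_mem (mul_mem (mul_mem hy hy') (inv_mem hy)) (inv_mem hy')
    rw [← relIndex_mul_index (le_sup_left : H ≤ H ⊔ (⊤ : Subgroup G).lowerCentralSeries n),
      relIndex_sup_of_le_center H hc]
    exact mul_ne_zero h2 h1

/-- In a finitely generated nilpotent group, `H` has finite index in `H^*`. -/
theorem relIndex_isolator_ne_zero {G : Type*} [Group G] [Group.FG G] [Group.IsNilpotent G]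
    (H : Subgroup G) : H.relIndex (isolator H) ≠ 0 := by
  set S : Set G := {g | ∃ m : ℕ, 0 < m ∧ g ^ m ∈ H} with hS
  set K := Subgroup.closure S with hK
  have hHK : H ≤ K := fun x hx => subset_closure ⟨1, one_pos, by simpa using hx⟩
  have : Group.FG K := (Group.fg_iff_subgroup_fg K).2 (subgroup_fg_of_isNilpotent K)
  obtain ⟨n, hn⟩ := Subgroup.nilpotent_iff_lowerCentralSeries.1
    (inferInstance : Group.IsNilpotent K)
  have h1 : (H.subgroupOf K).index ≠ 0 :=
    index_ne_zero_of_closure_roots n hn (closure_closure_coe_preimage (k := S))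
      (by
        rintro s ⟨m, hm, hsm⟩
        exact ⟨m, hm, hsm⟩)
  -- Finite index makes every element of `K` a root of an element of `H`, so a root of an element of
  -- `K` is again one of the generators.
  have hroot : RootClosed K := by
    intro g i hi hg
    obtain ⟨m, hm, -, hgm⟩ := exists_pow_mem_of_relIndex_ne_zero h1 hg
    exact subset_closure ⟨i * m, mul_pos hi hm, by rw [pow_mul]; exact hgm.1⟩
  exact fun h0 => h1 (relIndex_eq_zero_of_le_right ((isolator_isLeast H).2 ⟨hHK, hroot⟩) h0)

/-! ### Counting subgroups of bounded index. -/

/-- A finitely generated group has finitely many subgroups of a given finite index. -/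
theorem finite_setOf_index_eq {G : Type*} [Group G] [Group.FG G] {n : ℕ} (hn : n ≠ 0) :
    {H : Subgroup G | H.index = n}.Finite := by
  have : Finite (G →* Equiv.Perm (Fin n)) := by
    obtain ⟨S, hS⟩ := Group.fg_def.1 ‹Group.FG G›
    refine Finite.of_injective (fun (f : G →* Equiv.Perm (Fin n)) (s : S) => f s) ?_
    intro f g hfg
    exact MonoidHom.eq_of_eqOn_dense hS fun s hs => congrFun hfg ⟨s, hs⟩
  -- `H` is the stabilizer of the trivial coset in the action on `G ⧸ H`, so it is recovered from a
  -- homomorphism to `Perm (Fin n)` and a point.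
  refine (Set.finite_range fun p : (G →* Equiv.Perm (Fin n)) × Fin n =>
    (MulAction.stabilizer (Equiv.Perm (Fin n)) p.2).comap p.1).subset ?_
  rintro H rfl
  have : Finite (G ⧸ H) := Nat.finite_of_card_ne_zero hn
  let e : G ⧸ H ≃ Fin H.index := Finite.equivFin _
  refine ⟨(e.permCongrHom.toMonoidHom.comp (MulAction.toPermHom G (G ⧸ H)), e (1 : G)), ?_⟩
  ext g
  simp [MulAction.mem_stabilizer_iff]
  rw [eq_comm, QuotientGroup.eq]
  simp

theorem finite_setOf_relIndex_le {G : Type*} [Group G] {K : Subgroup G} (hK : K.FG) (n : ℕ) :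
    {H : Subgroup G | H ≤ K ∧ H.relIndex K ≠ 0 ∧ H.relIndex K ≤ n}.Finite := by
  have : Group.FG K := (Group.fg_iff_subgroup_fg K).2 hK
  have h : (⋃ m ∈ Set.Icc 1 n, {H : Subgroup K | H.index = m}).Finite :=
    (Set.finite_Icc 1 n).biUnion fun m hm => finite_setOf_index_eq (by have := hm.1; omega)
  refine (h.image (Subgroup.map K.subtype)).subset ?_
  rintro H ⟨hHK, h0, hn⟩
  refine ⟨H.subgroupOf K, ?_, by rw [subgroupOf_map_subtype, inf_of_le_left hHK]⟩
  simp only [Set.mem_iUnion]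
  exact ⟨_, ⟨Nat.one_le_iff_ne_zero.2 h0, hn⟩, rfl⟩

end WeightPairs

/-! ### Induced representations as spaces of functions on the group. -/

namespace WeightPairs

open Subgroup
open scoped TensorProduct

open Classical in
/-- The function `y ↦ χ (y x⁻¹)` on the coset `H x`, extended by zero. -/
noncomputable def cosetFun {G : Type*} [Group G] {H : Subgroup G} (χ : H →* ℂˣ) (x : G) : G → ℂ :=
  fun y => if h : y * x⁻¹ ∈ H then (χ ⟨y * x⁻¹, h⟩ : ℂ) else 0

theorem cosetFun_of_mem {G : Type*} [Group G] {H : Subgroup G} (χ : H →* ℂˣ) {x y : G}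
    (h : y * x⁻¹ ∈ H) : cosetFun χ x y = χ ⟨y * x⁻¹, h⟩ := dif_pos h

theorem cosetFun_of_notMem {G : Type*} [Group G] {H : Subgroup G} (χ : H →* ℂˣ) {x y : G}
    (h : y * x⁻¹ ∉ H) : cosetFun χ x y = 0 := dif_neg h

theorem cosetFun_mul_left {G : Type*} [Group G] {H : Subgroup G} (χ : H →* ℂˣ) (x y : G) (h : H) :
    cosetFun χ x (h * y) = χ h * cosetFun χ x y := by
  by_cases hy : y * x⁻¹ ∈ H
  · have hy' : (h : G) * y * x⁻¹ ∈ H := by rw [mul_assoc]; exact H.mul_mem h.2 hy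
    rw [cosetFun_of_mem χ hy, cosetFun_of_mem χ hy', ← Units.val_mul, ← map_mul]
    congr 3
    simp [mul_assoc]
  · have hy' : (h : G) * y * x⁻¹ ∉ H := by
      rwa [mul_assoc, H.mul_mem_cancel_left h.2]
    rw [cosetFun_of_notMem χ hy, cosetFun_of_notMem χ hy', mul_zero]

/-- This is the relation that lets `toFun` descend to coinvariants. -/
theorem cosetFun_coset_mul {G : Type*} [Group G] {H : Subgroup G} (χ : H →* ℂˣ) (x y : G) (h : H) :
    χ h * cosetFun χ (h * x) y = cosetFun χ x y := by
  by_cases hy : y * x⁻¹ ∈ H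
  · have hy' : y * (h * x)⁻¹ ∈ H := by
      rw [mul_inv_rev, ← mul_assoc]; exact H.mul_mem hy (H.inv_mem h.2)
    rw [cosetFun_of_mem χ hy, cosetFun_of_mem χ hy', mul_comm, ← Units.val_mul, ← map_mul]
    congr 3
    ext
    simp [mul_assoc]
  · have hy' : y * (h * x)⁻¹ ∉ H := by
      rwa [mul_inv_rev, ← mul_assoc, H.mul_mem_cancel_right (H.inv_mem h.2)]
    rw [cosetFun_of_notMem χ hy, cosetFun_of_notMem χ hy', mul_zero]

theorem cosetFun_mul_inv {G : Type*} [Group G] {H : Subgroup G} (χ : H →* ℂˣ) (x y g : G) :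
    cosetFun χ (x * g⁻¹) y = cosetFun χ x (y * g) := by
  have : y * (x * g⁻¹)⁻¹ = y * g * x⁻¹ := by group
  classical
  exact congrArg (fun z => if h : z ∈ H then (χ ⟨z, h⟩ : ℂ) else 0) this

/-- The realization of the induced representation by functions on `G`. -/
noncomputable def toFun {G : Type*} [Group G] (H : Subgroup G) (χ : H →* ℂˣ) :
    Representation.IndV H.subtype (charRep χ) →ₗ[ℂ] (G → ℂ) :=
  Representation.Coinvariants.lift _
    (TensorProduct.lift <| (Finsupp.lift _ _ _ fun x =>
        LinearMap.toSpanSingleton ℂ (G → ℂ) (cosetFun χ x)) ∘ₗ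
      (MonoidAlgebra.coeffLinearEquiv ℂ).toLinearMap)
    fun h => by
      ext x y
      simpa [charRep] using cosetFun_coset_mul χ x y h

/-- The coset generator `x⁻¹ ⊗ 1` of the induced representation. -/
noncomputable def gen {G : Type*} [Group G] (H : Subgroup G) (χ : H →* ℂˣ) (x : G) :
    Representation.IndV H.subtype (charRep χ) :=
  Representation.IndV.mk H.subtype (charRep χ) x 1

section

variable {G : Type*} [Group G] {H : Subgroup G} {χ : H →* ℂˣ}

@[simp]
theorem toFun_gen (x : G) : toFun H χ (gen H χ x) = cosetFun χ x := by
  simp [toFun, gen]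

theorem indChar_gen (g x : G) : indChar H χ g (gen H χ x) = gen H χ (x * g⁻¹) :=
  Representation.ind_mk _ _ _ _ _

theorem indV_induction {p : Representation.IndV H.subtype (charRep χ) → Prop}
    (v : Representation.IndV H.subtype (charRep χ)) (h0 : p 0)
    (hgen : ∀ x, p (gen H χ x)) (hadd : ∀ v w, p v → p w → p (v + w))
    (hsmul : ∀ (c : ℂ) v, p v → p (c • v)) : p v := by
  let P : Submodule ℂ (Representation.IndV H.subtype (charRep χ)) :=
    Submodule.span ℂ (Set.range (gen H χ))
  have hP : P = ⊤ := by
    rw [← Submodule.ker_mkQ P, LinearMap.ker_eq_top]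
    ext x
    exact (Submodule.Quotient.mk_eq_zero P).2 (Submodule.subset_span ⟨x, rfl⟩)
  have hv : v ∈ P := hP ▸ Submodule.mem_top
  induction hv using Submodule.span_induction with
  | mem _ h => obtain ⟨x, rfl⟩ := h; exact hgen x
  | zero => exact h0
  | add _ _ _ _ h h' => exact hadd _ _ h h'
  | smul c _ _ h => exact hsmul c _ h

theorem toFun_indChar (g : G) (v : Representation.IndV H.subtype (charRep χ)) (y : G) :
    toFun H χ (indChar H χ g v) y = toFun H χ v (y * g) := by
  induction v using indV_induction with
  | h0 => simp
  | hgen x => rw [indChar_gen, toFun_gen, toFun_gen, cosetFun_mul_inv]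
  | hadd v w hv hw => simp only [map_add, Pi.add_apply, hv, hw]
  | hsmul c v hv => simp only [map_smul, Pi.smul_apply, hv]

theorem toFun_mul_left (v : Representation.IndV H.subtype (charRep χ)) (h : H) (y : G) :
    toFun H χ v (h * y) = χ h * toFun H χ v y := by
  induction v using indV_induction with
  | h0 => simp
  | hgen x => rw [toFun_gen, cosetFun_mul_left]
  | hadd v w hv hw => simp only [map_add, Pi.add_apply, hv, hw, mul_add]
  | hsmul c v hv => simp only [map_smul, Pi.smul_apply, hv, smul_eq_mul]; ring

theorem exists_finite_support (v : Representation.IndV H.subtype (charRep χ)) :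
    ∃ S : Set G, S.Finite ∧ ∀ y, toFun H χ v y ≠ 0 → ∃ x ∈ S, y * x⁻¹ ∈ H := by
  induction v using indV_induction with
  | h0 => exact ⟨∅, Set.finite_empty, by simp⟩
  | hgen x =>
    refine ⟨{x}, Set.finite_singleton x, fun y hy => ⟨x, rfl, ?_⟩⟩
    by_contra h
    exact hy (by rw [toFun_gen, cosetFun_of_notMem χ h])
  | hadd v w hv hw =>
    obtain ⟨S, hS, h1⟩ := hv
    obtain ⟨T, hT, h2⟩ := hw
    refine ⟨S ∪ T, hS.union hT, fun y hy => ?_⟩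
    by_cases hvy : toFun H χ v y = 0
    · obtain ⟨x, hx, h⟩ := h2 y (fun hwy => hy (by simp [hvy, hwy]))
      exact ⟨x, Or.inr hx, h⟩
    · obtain ⟨x, hx, h⟩ := h1 y hvy
      exact ⟨x, Or.inl hx, h⟩
  | hsmul c v hv =>
    obtain ⟨S, hS, h1⟩ := hv
    exact ⟨S, hS, fun y hy => h1 y fun h => hy (by simp [h])⟩

theorem indChar_gen_one (h : H) : indChar H χ h (gen H χ 1) = (χ h : ℂ) • gen H χ 1 := by
  rw [indChar_gen, one_mul, gen, gen, ← map_smul]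
  have := Representation.Coinvariants.mk_self_apply (Representation.tprod
    ((Representation.leftRegular ℂ G).comp H.subtype) (charRep χ)) h
    (MonoidAlgebra.single (h : G)⁻¹ 1 ⊗ₜ 1)
  rw [show Representation.tprod ((Representation.leftRegular ℂ G).comp H.subtype) (charRep χ) h
    (MonoidAlgebra.single (h : G)⁻¹ 1 ⊗ₜ 1) = MonoidAlgebra.single 1 1 ⊗ₜ ((χ h : ℂ) • 1) by
      simp [charRep]] at this
  exact this.symm

theorem toFun_gen_one_one : toFun H χ (gen H χ 1) 1 = 1 := by
  have h : (1 : G) * 1⁻¹ ∈ H := by simp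
  rw [toFun_gen, cosetFun_of_mem χ h, Units.val_eq_one, ← map_one χ]
  congr 1
  ext
  simp

/-- The kernel is a subrepresentation that misses `gen H χ 1`, so irreducibility makes it zero. -/
theorem toFun_injective [hirr : (indChar H χ).IsIrreducible] :
    Function.Injective (toFun H χ) := by
  let P : Subrepresentation (indChar H χ) :=
    { toSubmodule := LinearMap.ker (toFun H χ)
      apply_mem_toSubmodule := fun g v hv => by
        rw [LinearMap.mem_ker] at hv ⊢
        ext y
        rw [toFun_indChar, hv]
        rfl }
  have hP : P = ⊥ := by
    refine (eq_bot_or_eq_top P).resolve_right fun h => ?_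
    have : gen H χ 1 ∈ P.toSubmodule := h ▸ Submodule.mem_top
    have h1 := toFun_gen_one_one (χ := χ)
    rw [LinearMap.mem_ker.1 this] at h1
    exact zero_ne_one h1
  exact LinearMap.ker_eq_bot.1 (congrArg Subrepresentation.toSubmodule hP)

end

end WeightPairs

/-! ### Comparing the indices of two equivalent pairs. -/

namespace WeightPairs

open Subgroup

section

variable {G : Type*} [Group G] {H H' : Subgroup G} {χ : H →* ℂˣ} {χ' : H' →* ℂˣ}

theorem toFun_equiv_gen_mul (f : (indChar H' χ').Equiv (indChar H χ)) (h : H') (y : G) :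
    toFun H χ (f (gen H' χ' 1)) (y * h) = χ' h * toFun H χ (f (gen H' χ' 1)) y := by
  rw [← toFun_indChar]
  have : indChar H χ h (f (gen H' χ' 1)) = f (indChar H' χ' h (gen H' χ' 1)) :=
    (f.toIntertwiningMap.isIntertwining _ _ _ _).symm
  rw [this, indChar_gen_one, map_smul, map_smul, Pi.smul_apply, smul_eq_mul]

/-- By right equivariance the image function is nonzero at every `g * h ^ n`. Its support meets
finitely many cosets `H x`, so two exponents share a coset, and their difference is the required
power. -/
theorem exists_conj_pow_mem (f : (indChar H' χ').Equiv (indChar H χ)) {g : G}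
    (hg : toFun H χ (f (gen H' χ' 1)) g ≠ 0) (h : H') :
    ∃ m : ℕ, 0 < m ∧ g * (h : G) ^ m * g⁻¹ ∈ H := by
  obtain ⟨S, hS, hsupp⟩ := exists_finite_support (f (gen H' χ' 1))
  have hex : ∀ n : ℕ, ∃ x ∈ S, g * (h : G) ^ n * x⁻¹ ∈ H := fun n => by
    apply hsupp
    have := toFun_equiv_gen_mul f (h ^ n) g
    rw [coe_pow] at this
    rw [this]
    exact mul_ne_zero (Units.ne_zero _) hg
  choose x hxS hx using hex
  have : Finite S := hS
  obtain ⟨i, j, hij, hxx⟩ := Finite.exists_ne_map_eq_of_infinite (fun n => (⟨x n, hxS n⟩ : S))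
  have hxx' : x i = x j := congrArg Subtype.val hxx
  wlog hlt : i < j generalizing i j
  · exact this j i hij.symm hxx.symm hxx'.symm (by omega)
  refine ⟨j - i, by omega, ?_⟩
  have h1 := H.mul_mem (hx j) (H.inv_mem (hx i))
  rw [hxx'] at h1
  have h2 : (h : G) ^ j = h ^ (j - i) * h ^ i := by rw [← pow_add]; congr 1; omega
  convert h1 using 1
  rw [h2]
  group

theorem conj_mem_of_rootClosed {K : Subgroup G} (hHK : H ≤ K) (hK : RootClosed K)
    (hpow : ∀ k ∈ K, ∃ m : ℕ, 0 < m ∧ k ^ m ∈ H') (f : (indChar H' χ').Equiv (indChar H χ)) {g : G}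
    (hg : toFun H χ (f (gen H' χ' 1)) g ≠ 0) {k : G} (hk : k ∈ K) : g * k * g⁻¹ ∈ K := by
  obtain ⟨m, hm, hkm⟩ := hpow k hk
  obtain ⟨n, hn, hmn⟩ := exists_conj_pow_mem f hg ⟨_, hkm⟩
  refine hK _ (m * n) (mul_pos hm hn) ?_
  rw [conj_pow, pow_mul]
  exact hHK hmn

/-- A vector supported on `K` whose image vanishes on `K g` is zero. -/
theorem eq_zero_of_support_of_vanish {K : Subgroup G} [(indChar H' χ').IsIrreducible]
    (hH'K : H' ≤ K) (f : (indChar H' χ').Equiv (indChar H χ)) {g : G}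
    (hg : toFun H χ (f (gen H' χ' 1)) g ≠ 0) (hconj : ∀ k ∈ K, g * k * g⁻¹ ∈ K)
    {u : Representation.IndV H'.subtype (charRep χ')}
    (hu : ∀ y, y ∉ K → toFun H' χ' u y = 0)
    (hfu : ∀ k ∈ K, toFun H χ (f u) (k * g) = 0) : u = 0 := by
  -- The kernel of `u ↦ (f u)|_{K g}` on vectors supported on `K`; `B` below is the
  -- subrepresentation it generates.
  let U : Submodule ℂ (Representation.IndV H'.subtype (charRep χ')) :=
    { carrier := {u | (∀ y, y ∉ K → toFun H' χ' u y = 0) ∧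
        ∀ k ∈ K, toFun H χ (f u) (k * g) = 0}
      zero_mem' := by simp
      add_mem' := fun {a b} ha hb =>
        ⟨fun y hy => by simp [ha.1 y hy, hb.1 y hy], fun k hk => by simp [ha.2 k hk, hb.2 k hk]⟩
      smul_mem' := fun c a ha =>
        ⟨fun y hy => by simp [ha.1 y hy], fun k hk => by simp [ha.2 k hk]⟩ }
  let B : Subrepresentation (indChar H' χ') :=
    { toSubmodule := Submodule.span ℂ {v | ∃ x, ∃ u ∈ U, v = indChar H' χ' x u}
      apply_mem_toSubmodule := fun x v hv => by
        induction hv using Submodule.span_induction with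
        | mem _ h =>
          obtain ⟨z, u, hu, rfl⟩ := h
          exact Submodule.subset_span ⟨x * z, u, hu, by rw [map_mul]; rfl⟩
        | zero => rw [map_zero]; exact zero_mem _
        | add _ _ _ _ h h' => rw [map_add]; exact add_mem h h'
        | smul c _ _ h => rw [map_smul]; exact Submodule.smul_mem _ c h }
  -- Translating by `x ∈ K` preserves `U`, as `g x g⁻¹ ∈ K`; translating by `x ∉ K` moves the
  -- support off `K`. So restricting `B` to `K` yields nothing beyond `U`.
  have hB : ∀ v ∈ B.toSubmodule, ∃ u ∈ U, ∀ y ∈ K, toFun H' χ' u y = toFun H' χ' v y := by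
    intro v hv
    induction hv using Submodule.span_induction with
    | mem _ h =>
      obtain ⟨x, u, hu, rfl⟩ := h
      by_cases hx : x ∈ K
      · refine ⟨indChar H' χ' x u, ⟨fun y hy => ?_, fun k hk => ?_⟩, fun y _ => rfl⟩
        · rw [toFun_indChar]
          exact hu.1 _ (by rwa [K.mul_mem_cancel_right hx])
        · have : f (indChar H' χ' x u) = indChar H χ x (f u) :=
            f.toIntertwiningMap.isIntertwining _ _ _ _
          rw [this, toFun_indChar, show k * g * x = (k * (g * x * g⁻¹)) * g by group]
          exact hu.2 _ (K.mul_mem hk (hconj x hx))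
      · refine ⟨0, zero_mem _, fun y hy => ?_⟩
        rw [toFun_indChar, hu.1 _ (by rwa [K.mul_mem_cancel_left hy]), map_zero]
        rfl
    | zero => exact ⟨0, zero_mem _, fun _ _ => rfl⟩
    | add _ _ _ _ h h' =>
      obtain ⟨u, hu, h⟩ := h
      obtain ⟨u', hu', h'⟩ := h'
      exact ⟨u + u', add_mem hu hu', fun y hy => by simp [h y hy, h' y hy]⟩
    | smul c _ _ h =>
      obtain ⟨u, hu, h⟩ := h
      exact ⟨c • u, Submodule.smul_mem _ c hu, fun y hy => by simp [h y hy]⟩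
  have hbot : B = ⊥ := by
    refine (eq_bot_or_eq_top B).resolve_right fun htop => ?_
    -- If `B` were everything, the generator, being supported on `K`, would itself lie in `U`,
    -- against `hg`.
    obtain ⟨u, hu, huy⟩ := hB (gen H' χ' 1) (htop ▸ Submodule.mem_top)
    have : u = gen H' χ' 1 := by
      refine toFun_injective (funext fun y => ?_)
      by_cases hy : y ∈ K
      · exact huy y hy
      · rw [hu.1 y hy, toFun_gen, cosetFun_of_notMem]
        rw [inv_one, mul_one]
        exact fun h => hy (hH'K h)
    have h0 := hu.2 1 K.one_mem
    rw [this, one_mul] at h0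
    exact hg h0
  have hmem : u ∈ B.toSubmodule :=
    Submodule.subset_span ⟨1, u, ⟨hu, hfu⟩, by rw [map_one]; rfl⟩
  rw [hbot] at hmem
  exact hmem

theorem relIndex_le_of_equiv {K : Subgroup G} [(indChar H' χ').IsIrreducible]
    [(indChar H χ).IsIrreducible]
    (hHK : H ≤ K) (hH'K : H' ≤ K) (hK : RootClosed K) (h0 : H.relIndex K ≠ 0)
    (h0' : H'.relIndex K ≠ 0) (f : (indChar H' χ').Equiv (indChar H χ)) :
    H'.relIndex K ≤ H.relIndex K := by
  have hne : toFun H χ (f (gen H' χ' 1)) ≠ 0 := by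
    intro h
    have h1 : f (gen H' χ' 1) = 0 := toFun_injective (h.trans (map_zero _).symm)
    have h2 : gen H' χ' 1 = 0 := f.injective (h1.trans (map_zero f).symm)
    have h3 := toFun_gen_one_one (χ := χ')
    rw [h2, map_zero] at h3
    exact zero_ne_one h3
  obtain ⟨g, hg⟩ := Function.ne_iff.1 hne
  have hpow : ∀ k ∈ K, ∃ m : ℕ, 0 < m ∧ k ^ m ∈ H' := fun k hk => by
    obtain ⟨m, hm, -, h⟩ := exists_pow_mem_of_relIndex_ne_zero h0' hk
    exact ⟨m, hm, h.1⟩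
  have hconj : ∀ k ∈ K, g * k * g⁻¹ ∈ K := fun k hk => conj_mem_of_rootClosed hHK hK hpow f hg hk
  have : Finite (K ⧸ H.subgroupOf K) := Nat.finite_of_card_ne_zero h0
  have : Finite (K ⧸ H'.subgroupOf K) := Nat.finite_of_card_ne_zero h0'
  have := Fintype.ofFinite (K ⧸ H.subgroupOf K)
  have := Fintype.ofFinite (K ⧸ H'.subgroupOf K)
  -- The quotient consists of left cosets while the functions live on right cosets, hence the
  -- inverted representatives here and in `ev`.
  let w : K ⧸ H'.subgroupOf K → Representation.IndV H'.subtype (charRep χ') :=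
    fun i => gen H' χ' (i.out : G)⁻¹
  let ev : Representation.IndV H.subtype (charRep χ) →ₗ[ℂ] (K ⧸ H.subgroupOf K → ℂ) :=
    (LinearMap.funLeft ℂ ℂ fun i : K ⧸ H.subgroupOf K => (i.out : G)⁻¹ * g) ∘ₗ toFun H χ
  let T : (K ⧸ H'.subgroupOf K → ℂ) →ₗ[ℂ] (K ⧸ H.subgroupOf K → ℂ) :=
    ev ∘ₗ f.toLinearMap ∘ₗ Fintype.linearCombination ℂ w
  have hT : Function.Injective T := by
    rw [← LinearMap.ker_eq_bot, LinearMap.ker_eq_bot']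
    intro c hc
    set u := Fintype.linearCombination ℂ w c with hu
    have hu' : ∀ y, toFun H' χ' u y = ∑ i, c i * cosetFun χ' (i.out : G)⁻¹ y := fun y => by
      rw [hu, Fintype.linearCombination_apply]
      simp [w]
    have huz : u = 0 := by
      refine eq_zero_of_support_of_vanish (K := K) hH'K f hg hconj (fun y hy => ?_) fun k hk => ?_
      · rw [hu']
        refine Finset.sum_eq_zero fun i _ => ?_
        rw [cosetFun_of_notMem, mul_zero]
        rw [inv_inv]
        exact fun h => hy ((K.mul_mem_cancel_right i.out.2).1 (hH'K h))
      · have h1 := congrFun hc (QuotientGroup.mk (⟨k, hk⟩ : K)⁻¹)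
        set r := (QuotientGroup.mk (⟨k, hk⟩ : K)⁻¹ : K ⧸ H.subgroupOf K).out with hr
        have h2 : (⟨k, hk⟩ : K)⁻¹⁻¹ * r ∈ H.subgroupOf K :=
          QuotientGroup.eq.1 (QuotientGroup.out_eq' _).symm
        have h3 : k * (r : G) ∈ H := by simpa [mem_subgroupOf] using h2
        have h4 := toFun_mul_left (f u) ⟨_, h3⟩ ((r : G)⁻¹ * g)
        have h5 : toFun H χ (f u) ((r : G)⁻¹ * g) = 0 := h1
        rw [h5, mul_zero] at h4
        rw [← h4]
        group
    -- The functions of the `w i` have disjoint supports, so evaluating at the `j`-th representative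
    -- isolates `c j`.
    funext j
    have hj := hu' (j.out : G)⁻¹
    rw [huz, map_zero, Finset.sum_eq_single j] at hj
    · have h : (j.out : G)⁻¹ * ((j.out : G)⁻¹)⁻¹ ∈ H' := by simp
      rw [cosetFun_of_mem χ' h] at hj
      exact (mul_eq_zero.1 hj.symm).resolve_right (Units.ne_zero _)
    · intro i _ hij
      rw [cosetFun_of_notMem, mul_zero]
      rw [inv_inv]
      intro h
      apply hij
      rw [← QuotientGroup.out_eq' i, ← QuotientGroup.out_eq' j]
      exact (QuotientGroup.eq.2 (mem_subgroupOf.2 h)).symm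
    · simp
  have := LinearMap.finrank_le_finrank_of_injective hT
  rw [Module.finrank_fintype_fun_eq_card, Module.finrank_fintype_fun_eq_card,
    ← Nat.card_eq_fintype_card, ← Nat.card_eq_fintype_card] at this
  exact this

end

/-! ### Finiteness of the fibres. -/

theorem le_isolator {G : Type*} [Group G] (H : Subgroup G) : H ≤ isolator H :=
  (isolator_isLeast H).1.1

/-- The classes in a fibre `Z_H` over an element of `W` all coincide. -/
theorem injOn_fst_fibre {G : Type*} [Group G] (w : W G) :
    Set.InjOn Sigma.fst (phi ⁻¹' {w} : Set (Z G)) := by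
  rintro ⟨H, a⟩ ha ⟨H', b⟩ hb h
  obtain rfl : H = H' := h
  induction a using Quotient.inductionOn with | _ p
  induction b using Quotient.inductionOn with | _ q
  have hpq : phi ⟨H, Quotient.mk (fibreSetoid H) p⟩ = phi ⟨H, Quotient.mk (fibreSetoid H) q⟩ :=
    ha.trans hb.symm
  have h1 : Equivalent p.1 q.1 ∧ _ := Quotient.exact (s := starSetoid G) hpq
  rw [Quotient.sound (s := fibreSetoid H) h1.1]

end WeightPairs

theorem mainTheorem10 (G : Type*) [Group G] [Group.FG G] [Group.IsNilpotent G]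
    (w : WeightPairs.W G) : (WeightPairs.phi ⁻¹' {w}).Finite := by
  open WeightPairs in
  induction w using Quotient.inductionOn with | _ p
  refine Set.Finite.of_finite_image ?_ (injOn_fst_fibre _)
  refine Set.Finite.of_finite_image (f := Subtype.val) ?_ Subtype.val_injective.injOn
  refine (finite_setOf_relIndex_le (subgroup_fg_of_isNilpotent (isolator p.subgroup))
    (p.subgroup.relIndex (isolator p.subgroup))).subset ?_
  rintro _ ⟨_, ⟨⟨H, a⟩, ha, rfl⟩, rfl⟩
  induction a using Quotient.inductionOn with | _ q
  obtain ⟨⟨f⟩, hiso⟩ : Equivalent q.1 p ∧ isolator q.1.subgroup = isolator p.subgroup :=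
    Quotient.exact (s := starSetoid G) ha
  have hq : H.1 = q.1.subgroup := (congrArg Subtype.val q.2).symm
  have hle : q.1.subgroup ≤ isolator p.subgroup := hiso ▸ le_isolator _
  have h0 : q.1.subgroup.relIndex (isolator p.subgroup) ≠ 0 :=
    hiso ▸ relIndex_isolator_ne_zero q.1.subgroup
  have := p.irreducible
  have := q.1.irreducible
  simp only [Set.mem_ofPred_eq, hq]
  exact ⟨hle, h0, relIndex_le_of_equiv (le_isolator _) hle (isolator_isLeast _).1.2
    (relIndex_isolator_ne_zero _) h0 f⟩
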